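/- Let $\mathbb{H}=\{z\in\mathbb{C}:\operatorname{Im} z>0\}$ and let $f:\mathbb{H}\to\mathbb{H}$ be a holomorphic self-map without fixed points in $\mathbb{H}$ whose Denjoy--Wolff point is $\infty$ (that is, the iterates $f^n$ converge to $\infty$ locally uniformly on $\mathbb{H}$). Suppose that $f$ is hyperbolic, i.e. the angular derivative $f'(\infty)=\angle\lim_{z\to\infty} f(z)/z$ satisfies $f'(\infty)>1$, where $\angle\lim_{z\to\infty}$ denotes the limit as $z\to\infty$ within each sector $\{|\operatorname{Re} z|\le a\operatorname{Im} z\}$, $a>0$. Suppose that $f$ is represented by the Herglotz triplet $(\alpha,\beta,\mu)$, i.e. $$f(z)=\alpha z+\beta+\int_{\mathbb{R}}\frac{1+tz}{t-z}\,d\mu(t),\qquad z\in\mathbb{H},$$ with $\alpha\ge 0$, $\beta\in\mathbb{R}$ and $\mu$ a positive finite Borel measure on $\mathbb{R}$ (so that $\alpha=f'(\infty)$). Say that $f$ is of extremal rate if $\lim_{n\to\infty} f^n(z)/f'(\infty)^n$ exists and lies in $\mathbb{H}$ for some $z\in\mathbb{H}$. Then $f$ is of extremal rate if and only if $$\int_{\mathbb{R}}\log(1+|t|)\,d\mu(t)<+\infty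 ,$$ and this integral condition is also equivalent to: for every $z\in\mathbb{H}$, the limit $\lim_{n\to\infty} f^n(z)/\alpha^n$ exists and lies in $\mathbb{H}$. -/

import Mathlib

open Filter Topology MeasureTheory
open scoped UpperHalfPlane Manifold ENNReal

namespace HalfPlaneDynamics

/-- The filter of points of `ℍ` tending to `∞` inside the sector `|Re z| ≤ a Im z`. -/
noncomputable def sectorAtInfty (a : ℝ) : Filter ℍ :=
  comap ((↑) : ℍ → ℂ) (Bornology.cobounded ℂ) ⊓ 𝓟 {z : ℍ | |z.re| ≤ a * z.im}

/-- The angular (non-tangential) limit of `g : ℍ → ℂ` at `∞` exists and equals `l`: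
`g z → l` as `z → ∞` inside every sector `|Re z| ≤ a Im z`. -/
def HasAngularLimitAtInfty (g : ℍ → ℂ) (l : ℂ) : Prop :=
  ∀ a : ℝ, 0 < a → Tendsto g (sectorAtInfty a) (𝓝 l)

/-- The angular derivative at `∞`: `f'(∞) = ∠lim_{z → ∞} f(z) / z` exists and equals `a`. -/
def HasAngularDerivAtInfty (f : ℍ → ℍ) (a : ℝ) : Prop :=
  HasAngularLimitAtInfty (fun z => (f z : ℂ) / (z : ℂ)) (a : ℂ)

/-- `∞` is the Denjoy--Wolff point of `f`: the iterates of `f` converge to `∞` uniformly on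
every compact subset of `ℍ`. -/
def DenjoyWolffInfty (f : ℍ → ℍ) : Prop :=
  ∀ K : Set ℍ, IsCompact K →
    Tendsto (fun p : ℕ × ℍ => ((f^[p.1] p.2 : ℍ) : ℂ)) (atTop ×ˢ 𝓟 K) (Bornology.cobounded ℂ)

/-- Hyperbolic holomorphic self-maps of `ℍ` with Denjoy--Wolff point `∞`. -/
structure IsHyperbolic (f : ℍ → ℍ) : Prop where
  holomorphic : MDifferentiable 𝓘(ℂ) 𝓘(ℂ) (fun z : ℍ => (f z : ℂ))
  nonelliptic : ∀ z : ℍ, f z ≠ z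
  denjoyWolff : DenjoyWolffInfty f
  angularDeriv : ∃ a : ℝ, 1 < a ∧ HasAngularDerivAtInfty f a

/-- `f` is represented by the Herglotz triplet `(α, β, μ)`. The integrand is bounded in `t`
for each `z ∈ ℍ`, so it is integrable for the finite measure `μ`. -/
structure IsRepresentedBy (f : ℍ → ℍ) (α β : ℝ) (μ : Measure ℝ) : Prop where
  nonneg : 0 ≤ α
  finite : IsFiniteMeasure μ
  eq : ∀ z : ℍ, (f z : ℂ) =
    (α : ℂ) * (z : ℂ) + (β : ℂ) + ∫ t : ℝ, (1 + (t : ℂ) * (z : ℂ)) / ((t : ℂ) - (z : ℂ)) ∂μ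

/-- The limit of `f^n(z) / a^n` as `n → ∞` exists and lies in `ℍ`. -/
def OrbitLimitInH (f : ℍ → ℍ) (a : ℝ) (z : ℍ) : Prop :=
  ∃ L : ℍ, Tendsto (fun n : ℕ => ((f^[n] z : ℍ) : ℂ) / (a : ℂ) ^ n) atTop (𝓝 (L : ℂ))

/-- A hyperbolic `f` is of extremal rate if, with `a = f'(∞)`, the limit of `f^n(z) / a^n`
exists and lies in `ℍ` for some `z ∈ ℍ`. (The angular derivative `a` is unique.) -/
def IsOfExtremalRate (f : ℍ → ℍ) : Prop :=
  ∃ a : ℝ, HasAngularDerivAtInfty f a ∧ ∃ z : ℍ, OrbitLimitInH f a z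

end HalfPlaneDynamics

/-! Write `z_n = f^n(z)` and `y_n = Im z_n`. The Herglotz formula gives `Im f(z) = Im z (α + P(z))`
with `P` the `poissonIntegral`, so `y_n / α^n` is nondecreasing. Schwarz–Pick bounds the hyperbolic
steps of the orbit; since `y_n` grows at least like `α^n`, the orbit stays in a sector. Log moment
implies extremal rate: in a sector the kernel is at most a constant plus a multiple of `min(|t|,
|z|)`. Hence the relative increments of `z_n / α^n` are `O(α^{-n} + ∫ min(|t|/α^n, 1) dμ)`. These
are summable because about `log|t| / log α` scales `α^n` lie below `|t|`. The limit is in `ℍ`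
because `y_n / α^n ≥ y_0`. Conversely, if `|z_n| ≤ M α^n`, each increment of `y_n / α^n` dominates a
multiple of `μ(|t| ≥ M α^n)`. The increments telescope to a bounded quantity, and summability of
these tails is the log moment. -/

namespace HalfPlaneDynamics

/-! ### Kernel estimates, Schwarz–Pick and the angular derivative. -/

/-- The kernel `(1 + t z) / (t - z)` of the Herglotz representation. -/
noncomputable def herglotzKernel (t : ℝ) (z : ℂ) : ℂ := (1 + (t : ℂ) * z) / ((t : ℂ) - z)

lemma measurable_herglotzKernel (z : ℂ) : Measurable fun t : ℝ => herglotzKernel t z := by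
  unfold herglotzKernel
  fun_prop

lemma im_le_norm_ofReal_sub (t : ℝ) (z : ℍ) : z.im ≤ ‖(t : ℂ) - z‖ := by
  have h := Complex.abs_im_le_norm ((t : ℂ) - z)
  have h2 : ((t : ℂ) - z).im = -z.im := by simp
  rw [h2, abs_neg, abs_of_pos z.im_pos] at h
  exact h

lemma ofReal_sub_ne_zero (t : ℝ) (z : ℍ) : (t : ℂ) - z ≠ 0 :=
  norm_pos_iff.1 (z.im_pos.trans_le (im_le_norm_ofReal_sub t z))

/-- In a sector `|t - z|` controls both `|t|` and `|z|`. Keeping the minimum of the two is what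
later yields a summable bound. -/
lemma norm_herglotzKernel_le (t : ℝ) (z : ℍ) {A : ℝ} (hz : ‖(z : ℂ)‖ ≤ A * z.im) :
    ‖herglotzKernel t z‖ ≤ 1 / z.im + (1 + A) * min |t| ‖(z : ℂ)‖ := by
  have hy := z.im_pos
  have h1 := im_le_norm_ofReal_sub t z
  have hd : 0 < ‖(t : ℂ) - z‖ := hy.trans_le h1
  have hA : 0 ≤ A := by
    by_contra! h
    have := norm_nonneg (z : ℂ)
    nlinarith
  have h2 : ‖(z : ℂ)‖ ≤ A * ‖(t : ℂ) - z‖ := hz.trans (by gcongr)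
  have h3 : |t| ≤ (1 + A) * ‖(t : ℂ) - z‖ := by
    have : ‖(t : ℂ)‖ ≤ ‖(t : ℂ) - z‖ + ‖(z : ℂ)‖ := by
      simpa using norm_add_le ((t : ℂ) - z) z
    rw [Complex.norm_real, Real.norm_eq_abs] at this
    linarith
  have h4 : |t| * ‖(z : ℂ)‖ ≤ (1 + A) * min |t| ‖(z : ℂ)‖ * ‖(t : ℂ) - z‖ := by
    rcases min_choice |t| ‖(z : ℂ)‖ with h | h <;> rw [h]
    · have := mul_le_mul_of_nonneg_left h2 (abs_nonneg t)
      have := mul_nonneg (abs_nonneg t) hd.le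
      nlinarith
    · have := mul_le_mul_of_nonneg_right h3 (norm_nonneg (z : ℂ))
      nlinarith
  have h5 : ‖1 + (t : ℂ) * z‖ ≤ 1 + |t| * ‖(z : ℂ)‖ := by
    simpa using norm_add_le (1 : ℂ) ((t : ℂ) * z)
  have h6 : 1 ≤ 1 / z.im * ‖(t : ℂ) - z‖ := by
    rw [one_div, inv_mul_eq_div, one_le_div hy]
    exact h1
  rw [herglotzKernel, norm_div, div_le_iff₀ hd, add_mul]
  linarith

lemma integrable_herglotzKernel (μ : Measure ℝ) [IsFiniteMeasure μ] (z : ℍ) :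
    Integrable (fun t : ℝ => herglotzKernel t z) μ := by
  refine Integrable.of_bound (measurable_herglotzKernel z).aestronglyMeasurable
    (1 / z.im + (1 + ‖(z : ℂ)‖ / z.im) * ‖(z : ℂ)‖) (ae_of_all _ fun t => ?_)
  have hy := z.im_pos
  refine (norm_herglotzKernel_le t z (A := ‖(z : ℂ)‖ / z.im)
    (div_mul_cancel₀ _ hy.ne').ge).trans ?_
  gcongr
  exact min_le_right _ _

lemma herglotzKernel_im (t : ℝ) (z : ℍ) :
    (herglotzKernel t z).im = z.im * ((1 + t ^ 2) / ‖(t : ℂ) - z‖ ^ 2) := by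
  have h := ofReal_sub_ne_zero t z
  have h2 : Complex.normSq ((t : ℂ) - z) ≠ 0 := by simpa using h
  rw [← Complex.normSq_eq_norm_sq, herglotzKernel, Complex.div_im]
  field_simp
  simp
  ring

/-- The integral `∫ (1 + t²) / |t - z|² dμ(t)`, so that `α` plus this integral is
`Im f(z) / Im z` when `f` has Herglotz triplet `(α, β, μ)`. -/
noncomputable def poissonIntegral (μ : Measure ℝ) (z : ℍ) : ℝ :=
  ∫ t : ℝ, (1 + t ^ 2) / ‖(t : ℂ) - z‖ ^ 2 ∂μ

lemma integrable_poissonKernel (μ : Measure ℝ) [IsFiniteMeasure μ] (z : ℍ) :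
    Integrable (fun t : ℝ => (1 + t ^ 2) / ‖(t : ℂ) - z‖ ^ 2) μ := by
  have h := (integrable_herglotzKernel μ z).im.const_mul (z.im⁻¹)
  refine h.congr (ae_of_all _ fun t => ?_)
  change z.im⁻¹ * (herglotzKernel t z).im = _
  rw [herglotzKernel_im, inv_mul_cancel_left₀ z.im_pos.ne']

lemma poissonIntegral_nonneg (μ : Measure ℝ) (z : ℍ) : 0 ≤ poissonIntegral μ z :=
  integral_nonneg fun t => by positivity

lemma IsRepresentedBy.eq_kernel {f : ℍ → ℍ} {α β : ℝ} {μ : Measure ℝ}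
    (h : IsRepresentedBy f α β μ) (z : ℍ) :
    (f z : ℂ) = α * z + β + ∫ t : ℝ, herglotzKernel t z ∂μ := h.eq z

lemma IsRepresentedBy.im_eq {f : ℍ → ℍ} {α β : ℝ} {μ : Measure ℝ}
    (h : IsRepresentedBy f α β μ) (z : ℍ) :
    (f z).im = z.im * (α + poissonIntegral μ z) := by
  have := h.finite
  have h1 := congrArg Complex.im (h.eq_kernel z)
  have h2 : (∫ t : ℝ, herglotzKernel t z ∂μ).im = ∫ t : ℝ, (herglotzKernel t z).im ∂μ :=
    (integral_im (integrable_herglotzKernel μ z)).symm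
  simp only [herglotzKernel_im, integral_const_mul] at h2
  rw [Complex.add_im, h2] at h1
  simp only [UpperHalfPlane.coe_im, Complex.add_im, Complex.mul_im, Complex.ofReal_re,
    Complex.ofReal_im] at h1
  rw [h1, poissonIntegral]
  ring

lemma IsRepresentedBy.mul_im_le {f : ℍ → ℍ} {α β : ℝ} {μ : Measure ℝ}
    (h : IsRepresentedBy f α β μ) (z : ℍ) : α * z.im ≤ (f z).im := by
  rw [h.im_eq]
  have := mul_nonneg z.im_pos.le (poissonIntegral_nonneg μ z)
  linarith

/-- Weighted AM-GM. The weight `s` stays free so that it can be optimized after integration in `t`,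
replacing Cauchy–Schwarz. -/
lemma norm_herglotzKernel_sub_le (t : ℝ) (z w : ℍ) {s : ℝ} (hs : 0 < s) :
    ‖herglotzKernel t z - herglotzKernel t w‖ ≤
      ‖(z : ℂ) - w‖ * ((s * ((1 + t ^ 2) / ‖(t : ℂ) - z‖ ^ 2) +
        s⁻¹ * ((1 + t ^ 2) / ‖(t : ℂ) - w‖ ^ 2)) / 2) := by
  have hz := ofReal_sub_ne_zero t z
  have hw := ofReal_sub_ne_zero t w
  have e : herglotzKernel t z - herglotzKernel t w =
      (z - w) * ((1 + t ^ 2 : ℝ) * (((t : ℂ) - z)⁻¹ * ((t : ℂ) - w)⁻¹)) := by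
    rw [herglotzKernel, herglotzKernel]
    field_simp
    push_cast
    ring
  rw [e, norm_mul, norm_mul, norm_mul, norm_inv, norm_inv, Complex.norm_real,
    Real.norm_of_nonneg (by positivity)]
  refine mul_le_mul_of_nonneg_left ?_ (norm_nonneg _)
  simp only [div_eq_mul_inv, ← inv_pow]
  generalize ‖(t : ℂ) - z‖⁻¹ = a
  generalize ‖(t : ℂ) - w‖⁻¹ = b
  have key : 2 * (a * b) ≤ s * a ^ 2 + s⁻¹ * b ^ 2 := by
    have e : s * a ^ 2 + s⁻¹ * b ^ 2 - 2 * (a * b) = s⁻¹ * (s * a - b) ^ 2 := by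
      field_simp
      ring
    have : 0 ≤ s⁻¹ * (s * a - b) ^ 2 := by positivity
    linarith
  have := mul_le_mul_of_nonneg_left key (show 0 ≤ 1 + t ^ 2 by positivity)
  linarith

/-- The Schwarz--Pick inequality for a map given by a Herglotz representation. -/
lemma IsRepresentedBy.schwarzPick {f : ℍ → ℍ} {α β : ℝ} {μ : Measure ℝ}
    (h : IsRepresentedBy f α β μ) (z w : ℍ) :
    ‖(f z : ℂ) - f w‖ ^ 2 * (z.im * w.im) ≤ ‖(z : ℂ) - w‖ ^ 2 * ((f z).im * (f w).im) := by
  have := h.finite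
  set u := α + poissonIntegral μ z with hu
  set v := α + poissonIntegral μ w with hv
  have hz := z.im_pos
  have hw := w.im_pos
  have hfz : (f z).im = z.im * u := h.im_eq z
  have hfw : (f w).im = w.im * v := h.im_eq w
  have hu0 : 0 < u := pos_of_mul_pos_right (hfz ▸ (f z).im_pos) hz.le
  have hv0 : 0 < v := pos_of_mul_pos_right (hfw ▸ (f w).im_pos) hw.le
  have main : ∀ s : ℝ, 0 < s →
      ‖(f z : ℂ) - f w‖ ≤ ‖(z : ℂ) - w‖ * ((s * u + s⁻¹ * v) / 2) := by
    intro s hs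
    have e : (f z : ℂ) - f w = α * ((z : ℂ) - w) +
        ∫ t : ℝ, (herglotzKernel t z - herglotzKernel t w) ∂μ := by
      rw [integral_sub (integrable_herglotzKernel μ z) (integrable_herglotzKernel μ w),
        h.eq_kernel z, h.eq_kernel w]
      ring
    have iz := (integrable_poissonKernel μ z).const_mul s
    have iw := (integrable_poissonKernel μ w).const_mul s⁻¹
    have b := norm_integral_le_of_norm_le
      (((iz.add iw).div_const 2).const_mul ‖(z : ℂ) - w‖)
      (ae_of_all μ fun t => norm_herglotzKernel_sub_le t z w hs)
    simp only [Pi.add_apply] at b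
    rw [integral_const_mul, integral_div, integral_add iz iw, integral_const_mul,
      integral_const_mul] at b
    have hs2 : 2 ≤ s + s⁻¹ := by
      have e : s + s⁻¹ - 2 = s⁻¹ * (s - 1) ^ 2 := by
        field_simp
        ring
      have : 0 ≤ s⁻¹ * (s - 1) ^ 2 := by positivity
      linarith
    have h1 : ‖(α : ℂ) * ((z : ℂ) - w)‖ ≤ ‖(z : ℂ) - w‖ * ((s * α + s⁻¹ * α) / 2) := by
      rw [norm_mul, Complex.norm_real, Real.norm_of_nonneg h.nonneg, mul_comm]
      refine mul_le_mul_of_nonneg_left ?_ (norm_nonneg _)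
      nlinarith [mul_le_mul_of_nonneg_left hs2 h.nonneg]
    rw [e]
    refine (norm_add_le _ _).trans ((add_le_add h1 b).trans_eq ?_)
    rw [hu, hv, poissonIntegral, poissonIntegral]
    ring
  -- This `s` balances the two terms and turns the arithmetic mean into `√(uv)`.
  have hq := main (√v / √u) (by positivity)
  have e : (√v / √u * u + (√v / √u)⁻¹ * v) / 2 = √u * √v := by
    have hu' : √u ≠ 0 := by positivity
    have hv' : √v ≠ 0 := by positivity
    nth_rewrite 2 [← Real.mul_self_sqrt hu0.le]
    nth_rewrite 3 [← Real.mul_self_sqrt hv0.le]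
    field_simp
    ring
  rw [e] at hq
  have hsq := pow_le_pow_left₀ (norm_nonneg _) hq 2
  rw [mul_pow, mul_pow, Real.sq_sqrt hu0.le, Real.sq_sqrt hv0.le] at hsq
  rw [hfz, hfw]
  refine (mul_le_mul_of_nonneg_right hsq (by positivity : 0 ≤ z.im * w.im)).trans_eq ?_
  ring

/-- The angular derivative at `∞` is the linear coefficient of the Herglotz representation. -/
lemma IsRepresentedBy.angularDeriv_eq {f : ℍ → ℍ} {α β : ℝ} {μ : Measure ℝ}
    (h : IsRepresentedBy f α β μ) {a : ℝ} (ha : HasAngularDerivAtInfty f a) : a = α := by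
  have := h.finite
  -- Testing along the imaginary axis suffices, as it lies in every sector.
  let z : ℕ → ℍ := fun n => ⟨((n : ℂ) + 1) * Complex.I, by simp; positivity⟩
  have zc : ∀ n, (z n : ℂ) = ((n : ℂ) + 1) * Complex.I := fun n => rfl
  have zim : ∀ n, (z n).im = n + 1 := fun n => by
    rw [← UpperHalfPlane.coe_im, zc]; simp
  have zre : ∀ n, (z n).re = 0 := fun n => by
    rw [← UpperHalfPlane.coe_re, zc]; simp
  have znorm : ∀ n, ‖(z n : ℂ)‖ = n + 1 := fun n => by
    rw [zc, norm_mul, Complex.norm_I, mul_one]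
    exact_mod_cast Complex.norm_natCast (n + 1)
  have zinf : Tendsto (fun n => ‖(z n : ℂ)‖) atTop atTop := by
    simp only [znorm]
    exact tendsto_atTop_add_const_right _ _ tendsto_natCast_atTop_atTop
  have zsec : Tendsto z atTop (sectorAtInfty 1) := by
    refine tendsto_inf.2 ⟨tendsto_comap_iff.2 (tendsto_norm_atTop_iff_cobounded.1 zinf),
      tendsto_principal.2 (Eventually.of_forall fun n => ?_)⟩
    simp only [Set.mem_ofPred_eq, zre, abs_zero, one_mul]
    exact (z n).im_pos.le
  have l1 : Tendsto (fun n => (f (z n) : ℂ) / z n) atTop (𝓝 (a : ℂ)) :=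
    (ha 1 one_pos).comp zsec
  have hinv : Tendsto (fun n => ((z n : ℂ))⁻¹) atTop (𝓝 0) :=
    tendsto_inv₀_cobounded.comp (tendsto_norm_atTop_iff_cobounded.1 zinf)
  have hone : Tendsto (fun n : ℕ => 1 / ((n : ℝ) + 1)) atTop (𝓝 0) :=
    tendsto_one_div_add_atTop_nhds_zero_nat
  have bd : ∀ n t, ‖herglotzKernel t (z n) / z n‖ ≤
      (1 / ((n : ℝ) + 1) + 2 * min |t| (n + 1)) / (n + 1) := fun n t => by
    rw [norm_div, znorm]
    have := norm_herglotzKernel_le t (z n) (A := 1) (by rw [znorm, zim, one_mul])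
    rw [zim, znorm] at this
    norm_num at this ⊢
    gcongr
  have l2 : Tendsto (fun n => ∫ t : ℝ, herglotzKernel t (z n) / z n ∂μ) atTop
      (𝓝 (∫ _ : ℝ, (0 : ℂ) ∂μ)) := by
    refine tendsto_integral_of_dominated_convergence (fun _ => 3)
      (fun n => ((measurable_herglotzKernel _).div_const _).aestronglyMeasurable)
      (integrable_const _) (fun n => ae_of_all _ fun t => (bd n t).trans ?_)
      (ae_of_all _ fun t => ?_)
    · rw [div_le_iff₀ (by positivity)]
      have h1 : 1 / ((n : ℝ) + 1) ≤ 1 := by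
        rw [div_le_one (by positivity)]
        linarith [(Nat.cast_nonneg n : (0 : ℝ) ≤ n)]
      have h2 := min_le_right |t| ((n : ℝ) + 1)
      linarith [(Nat.cast_nonneg n : (0 : ℝ) ≤ n)]
    · refine squeeze_zero_norm (a := fun n : ℕ =>
        (1 / ((n : ℝ) + 1) + 2 * |t|) * (1 / ((n : ℝ) + 1))) (fun n => (bd n t).trans ?_) ?_
      · rw [mul_one_div]
        gcongr
        exact min_le_left _ _
      · simpa using (hone.add_const (2 * |t|)).mul hone
  have l3 : Tendsto (fun n => (f (z n) : ℂ) / z n) atTop (𝓝 (α : ℂ)) := by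
    have := ((hinv.const_mul (β : ℂ)).const_add (α : ℂ)).add l2
    simp only [integral_zero, mul_zero, add_zero] at this
    refine this.congr fun n => ?_
    have hz : (z n : ℂ) ≠ 0 := (z n).ne_zero
    rw [h.eq_kernel, integral_div]
    field_simp
  exact_mod_cast tendsto_nhds_unique l1 l3

end HalfPlaneDynamics

namespace HalfPlaneDynamics

/-! ### Growth and sectorial confinement of orbits. -/

section Orbit

variable {f : ℍ → ℍ} {α β : ℝ} {μ : Measure ℝ}

lemma IsRepresentedBy.pow_mul_im_le_iterate (h : IsRepresentedBy f α β μ) (z : ℍ) (n : ℕ) :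
    α ^ n * z.im ≤ (f^[n] z).im := by
  induction n with
  | zero => simp
  | succ n ih =>
    rw [Function.iterate_succ_apply', pow_succ']
    have := mul_le_mul_of_nonneg_left ih h.nonneg
    have := h.mul_im_le (f^[n] z)
    linarith

/-- By Schwarz–Pick the quotient of the two sides does not increase with `n`, so its value at `n =
0` serves as `D`. -/
lemma IsRepresentedBy.exists_norm_iterate_sub_le (h : IsRepresentedBy f α β μ) (z : ℍ) :
    ∃ D : ℝ, 0 ≤ D ∧ ∀ n : ℕ, ‖(f^[n + 1] z : ℂ) - f^[n] z‖ ^ 2 ≤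
      D * ((f^[n + 1] z).im * (f^[n] z).im) := by
  have hp : ∀ n : ℕ, 0 < (f^[n + 1] z).im * (f^[n] z).im :=
    fun n => mul_pos (UpperHalfPlane.im_pos _) (UpperHalfPlane.im_pos _)
  refine ⟨‖(f z : ℂ) - z‖ ^ 2 / ((f z).im * z.im),
    div_nonneg (sq_nonneg _) (hp 0).le, fun n => ?_⟩
  induction n with
  | zero => exact (div_mul_cancel₀ _ (hp 0).ne').ge
  | succ n ih =>
    have sp := h.schwarzPick (f^[n + 1] z) (f^[n] z)
    rw [← Function.iterate_succ_apply' f, ← Function.iterate_succ_apply' f] at sp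
    refine le_of_mul_le_mul_right ?_ (hp n)
    have := mul_le_mul_of_nonneg_right ih (hp (n + 1)).le
    linarith

/-- Orbits stay in a sector. -/
lemma IsRepresentedBy.exists_norm_iterate_le (h : IsRepresentedBy f α β μ) (hα : 1 < α) (z : ℍ) :
    ∃ A : ℝ, 0 ≤ A ∧ ∀ n : ℕ, ‖(f^[n] z : ℂ)‖ ≤ A * (f^[n] z).im := by
  obtain ⟨D, hD, hstep⟩ := h.exists_norm_iterate_sub_le z
  -- The first entry starts the induction; the second gives `√D + A / α ≤ A`, which closes it.
  set A := max (‖(z : ℂ)‖ / z.im) (√D * α / (α - 1)) with hA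
  have hA1 : √D * α ≤ A * (α - 1) := (div_le_iff₀ (by linarith)).1 (le_max_right _ _)
  have hA0 : 0 ≤ A := le_max_of_le_left (div_nonneg (norm_nonneg _) z.im_pos.le)
  refine ⟨A, hA0, fun n => ?_⟩
  induction n with
  | zero => exact (div_le_iff₀ z.im_pos).1 (le_max_left _ _)
  | succ n ih =>
    have hy := (f^[n] z).im_pos
    have hy' := (f^[n + 1] z).im_pos
    have hmul : α * (f^[n] z).im ≤ (f^[n + 1] z).im := by
      rw [Function.iterate_succ_apply']
      exact h.mul_im_le _
    have hle : (f^[n] z).im ≤ (f^[n + 1] z).im := by nlinarith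
    have hd : ‖(f^[n + 1] z : ℂ) - f^[n] z‖ ≤ √D * (f^[n + 1] z).im := by
      refine le_of_sq_le_sq ?_ (by positivity)
      rw [mul_pow, Real.sq_sqrt hD, sq (f^[n + 1] z).im]
      exact (hstep n).trans (by gcongr)
    have htri : ‖(f^[n + 1] z : ℂ)‖ ≤ ‖(f^[n + 1] z : ℂ) - f^[n] z‖ + ‖(f^[n] z : ℂ)‖ := by
      simpa using norm_add_le ((f^[n + 1] z : ℂ) - f^[n] z) (f^[n] z)
    have h1 : √D * α * (f^[n + 1] z).im ≤ A * (α - 1) * (f^[n + 1] z).im := by gcongr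
    have h2 : A * (α * (f^[n] z).im) ≤ A * (f^[n + 1] z).im := by gcongr
    have h3 : α * ‖(f^[n + 1] z : ℂ)‖ ≤ α * (A * (f^[n + 1] z).im) := by
      have := mul_le_mul_of_nonneg_left (htri.trans (add_le_add hd ih)) h.nonneg
      linarith
    exact le_of_mul_le_mul_left h3 (by linarith)

end Orbit

/-! ### The logarithmic moment and geometric scales. -/

lemma exists_geometric_level {α M : ℝ} (hα : 1 < α) (hM : 0 < M) (t : ℝ) :
    ∃ N : ℕ, t < M * α ^ N ∧ ∀ n < N, M * α ^ n ≤ t := by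
  classical
  have hex : ∃ n : ℕ, t < M * α ^ n := by
    obtain ⟨n, hn⟩ := pow_unbounded_of_one_lt (t / M) hα
    exact ⟨n, by rwa [mul_comm, ← div_lt_iff₀ hM]⟩
  exact ⟨Nat.find hex, Nat.find_spec hex, fun n hn => not_lt.1 (Nat.find_min hex hn)⟩

/-- If `μ` has a finite logarithmic moment, then the truncated first moments at the scales
`α ^ n` are summable. -/
lemma summable_integral_min_of_log {μ : Measure ℝ} [IsFiniteMeasure μ] {α : ℝ} (hα : 1 < α)
    (hlog : ∫⁻ t : ℝ, ENNReal.ofReal (Real.log (1 + |t|)) ∂μ < ⊤) :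
    Summable fun n : ℕ => ∫ t : ℝ, min (|t| / α ^ n) 1 ∂μ := by
  have hα0 : 0 < α := by linarith
  have hL : 0 < Real.log α := Real.log_pos hα
  have hm : ∀ n : ℕ, Measurable fun t : ℝ => min (|t| / α ^ n) 1 := fun n => by fun_prop
  have hn0 : ∀ (n : ℕ) (t : ℝ), 0 ≤ min (|t| / α ^ n) 1 := fun n t => by positivity
  have hgeo : Summable fun n : ℕ => (α⁻¹) ^ n :=
    summable_geometric_of_lt_one (by positivity) (inv_lt_one_of_one_lt₀ hα)
  set G := ∑' n : ℕ, (α⁻¹) ^ n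
  have hG : 0 ≤ G := tsum_nonneg fun n => by positivity
  have pw : ∀ t : ℝ, ∑' n : ℕ, ENNReal.ofReal (min (|t| / α ^ n) 1) ≤
      ENNReal.ofReal (Real.log α)⁻¹ * ENNReal.ofReal (Real.log (1 + |t|)) +
        ENNReal.ofReal (1 + G) := by
    intro t
    obtain ⟨N, hN, hlt⟩ := exists_geometric_level hα one_pos |t|
    simp only [one_mul] at hN hlt
    have hNle : (N : ℝ) ≤ (Real.log α)⁻¹ * Real.log (1 + |t|) + 1 := by
      have hlog0 : 0 ≤ Real.log (1 + |t|) := Real.log_nonneg (by linarith [abs_nonneg t])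
      rcases Nat.eq_zero_or_pos N with rfl | hpos
      · simp only [Nat.cast_zero]
        positivity
      · obtain ⟨k, rfl⟩ : ∃ k, N = k + 1 := ⟨N - 1, by omega⟩
        have h1 := hlt k (Nat.lt_succ_self k)
        have h2 : Real.log (α ^ k) ≤ Real.log (1 + |t|) :=
          Real.log_le_log (by positivity) (by linarith)
        rw [Real.log_pow] at h2
        have h3 : (k : ℝ) ≤ (Real.log α)⁻¹ * Real.log (1 + |t|) := by
          rw [inv_mul_eq_div, le_div_iff₀ hL]
          exact h2
        push_cast
        linarith
    -- The first `N` terms are at most `1`; from `N` on, `|t| < α^N` gives a geometric tail.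
    have hpart : ∀ m : ℕ, ∑ n ∈ Finset.range m, min (|t| / α ^ n) 1 ≤ N + G := by
      intro m
      have h1 : ∑ n ∈ Finset.range m, min (|t| / α ^ n) 1 ≤
          ∑ n ∈ Finset.range (N + m), min (|t| / α ^ n) 1 :=
        Finset.sum_le_sum_of_subset_of_nonneg
          (Finset.range_subset_range.2 (by omega)) fun n _ _ => hn0 n t
      rw [Finset.sum_range_add] at h1
      refine h1.trans (add_le_add ?_ ?_)
      · refine (Finset.sum_le_sum fun n _ => min_le_right _ _).trans ?_
        simp
      · refine (Finset.sum_le_sum fun n _ => ?_).trans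
          (hgeo.sum_le_tsum (Finset.range m) fun n _ => by positivity)
        refine (min_le_left _ _).trans ?_
        rw [div_le_iff₀ (by positivity), pow_add, mul_comm, mul_assoc, ← mul_pow,
          mul_inv_cancel₀ hα0.ne', one_pow, mul_one]
        exact hN.le
    rw [← ENNReal.ofReal_mul (by positivity), ← ENNReal.ofReal_add
      (mul_nonneg (by positivity) (Real.log_nonneg (by linarith [abs_nonneg t])))
      (by positivity), ENNReal.tsum_eq_iSup_nat]
    refine iSup_le fun m => ?_
    rw [← ENNReal.ofReal_sum_of_nonneg fun n _ => hn0 n t]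
    exact ENNReal.ofReal_le_ofReal (by linarith [hpart m])
  have hsum : ∑' n : ℕ, ∫⁻ t : ℝ, ENNReal.ofReal (min (|t| / α ^ n) 1) ∂μ ≠ ⊤ := by
    rw [← lintegral_tsum fun n => (hm n).ennreal_ofReal.aemeasurable]
    refine ((lintegral_mono pw).trans_lt ?_).ne
    rw [lintegral_add_right _ measurable_const, lintegral_const_mul _ (by fun_prop),
      lintegral_const]
    exact ENNReal.add_lt_top.2 ⟨ENNReal.mul_lt_top ENNReal.ofReal_lt_top hlog,
      ENNReal.mul_lt_top ENNReal.ofReal_lt_top (measure_lt_top _ _)⟩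
  refine (ENNReal.summable_toReal hsum).congr fun n => ?_
  rw [integral_eq_lintegral_of_nonneg_ae (ae_of_all _ (hn0 n)) (hm n).aestronglyMeasurable]

/-- If the masses of `μ` outside the balls of radius `M α ^ n` have bounded partial sums, then
`μ` has a finite logarithmic moment. -/
lemma lintegral_log_lt_top_of_sum_tail_le {μ : Measure ℝ} [IsFiniteMeasure μ] {α M C : ℝ}
    (hα : 1 < α) (hM : 0 < M)
    (hC : ∀ m : ℕ, ∑ n ∈ Finset.range m, μ.real {t | M * α ^ n ≤ |t|} ≤ C) :
    ∫⁻ t : ℝ, ENNReal.ofReal (Real.log (1 + |t|)) ∂μ < ⊤ := by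
  have hL : 0 < Real.log α := Real.log_pos hα
  have hms : ∀ n : ℕ, MeasurableSet {t : ℝ | M * α ^ n ≤ |t|} := fun n =>
    measurableSet_le measurable_const measurable_id.abs
  have pw : ∀ t : ℝ, ENNReal.ofReal (Real.log (1 + |t|)) ≤
      ENNReal.ofReal (Real.log (1 + M)) +
        ENNReal.ofReal (Real.log α) * ∑' n : ℕ, {t : ℝ | M * α ^ n ≤ |t|}.indicator 1 t := by
    intro t
    obtain ⟨N, hN, hlt⟩ := exists_geometric_level hα hM |t|
    -- `N` counts exactly the levels `M α^n ≤ |t|`, so it equals the sum of the indicators.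
    have h1 : Real.log (1 + |t|) ≤ Real.log (1 + M) + Real.log α * N := by
      have hpow : 1 ≤ α ^ N := one_le_pow₀ hα.le
      have h2 : 1 + |t| ≤ (1 + M) * α ^ N := by linarith
      refine (Real.log_le_log (by positivity) h2).trans_eq ?_
      rw [Real.log_mul (by positivity) (by positivity), Real.log_pow]
      ring
    refine (ENNReal.ofReal_le_ofReal h1).trans ?_
    rw [ENNReal.ofReal_add (Real.log_nonneg (by linarith)) (by positivity),
      ENNReal.ofReal_mul hL.le, ENNReal.ofReal_natCast]
    gcongr
    refine le_trans ?_ (ENNReal.sum_le_tsum (Finset.range N))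
    refine le_of_eq ?_
    rw [Finset.sum_congr rfl fun n hn =>
      Set.indicator_of_mem (show t ∈ {t : ℝ | M * α ^ n ≤ |t|} from
        hlt n (Finset.mem_range.1 hn)) _]
    simp
  refine (lintegral_mono pw).trans_lt ?_
  rw [lintegral_add_left measurable_const, lintegral_const_mul _
    (Measurable.tsum fun n => measurable_one.indicator (hms n)), lintegral_const,
    lintegral_tsum fun n => (measurable_one.indicator (hms n)).aemeasurable]
  simp only [fun n => lintegral_indicator_one (μ := μ) (hms n)]
  have hsum : ∑' n : ℕ, μ {t | M * α ^ n ≤ |t|} ≤ ENNReal.ofReal C := by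
    rw [ENNReal.tsum_eq_iSup_nat]
    refine iSup_le fun m => ?_
    refine le_trans (le_of_eq ?_) (ENNReal.ofReal_le_ofReal (hC m))
    rw [ENNReal.ofReal_sum_of_nonneg fun n _ => measureReal_nonneg]
    exact Finset.sum_congr rfl fun n _ => (ofReal_measureReal (measure_ne_top _ _)).symm
  exact ENNReal.add_lt_top.2 ⟨ENNReal.mul_lt_top ENNReal.ofReal_lt_top (measure_lt_top _ _),
    ENNReal.mul_lt_top ENNReal.ofReal_lt_top (hsum.trans_lt ENNReal.ofReal_lt_top)⟩

end HalfPlaneDynamics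

namespace HalfPlaneDynamics

/-! ### Extremal rate and the logarithmic moment. -/

/-- A sequence whose relative increments are summable converges. -/
lemma exists_tendsto_of_norm_sub_le_mul {E : Type*} [NormedAddCommGroup E] [CompleteSpace E]
    {w : ℕ → E} {b : ℕ → ℝ} (hb0 : ∀ n, 0 ≤ b n) (hb : Summable b)
    (hw : ∀ n, ‖w (n + 1) - w n‖ ≤ ‖w n‖ * b n) : ∃ L : E, Tendsto w atTop (𝓝 L) := by
  -- Iterating `1 + b ≤ exp b` makes `w` bounded, so relative increments become absolute ones.
  have hbound : ∀ n, ‖w n‖ ≤ ‖w 0‖ * Real.exp (∑ k ∈ Finset.range n, b k) := by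
    intro n
    induction n with
    | zero => simp
    | succ n ih =>
      have h1 : ‖w (n + 1)‖ ≤ ‖w (n + 1) - w n‖ + ‖w n‖ := by
        simpa using norm_add_le (w (n + 1) - w n) (w n)
      have h2 : ‖w n‖ * (b n + 1) ≤ ‖w n‖ * Real.exp (b n) := by
        gcongr
        exact Real.add_one_le_exp _
      have h3 := mul_le_mul_of_nonneg_right ih (Real.exp_pos (b n)).le
      rw [Finset.sum_range_succ, Real.exp_add, ← mul_assoc]
      linarith [hw n]
  have hbound' : ∀ n, ‖w n‖ ≤ ‖w 0‖ * Real.exp (∑' k, b k) := fun n => by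
    refine (hbound n).trans ?_
    gcongr
    exact hb.sum_le_tsum _ fun k _ => hb0 k
  refine cauchySeq_tendsto_of_complete (cauchySeq_of_summable_dist ?_)
  refine Summable.of_nonneg_of_le (fun n => dist_nonneg) (fun n => ?_)
    (hb.mul_left (‖w 0‖ * Real.exp (∑' k, b k)))
  rw [dist_comm, dist_eq_norm]
  exact (hw n).trans (mul_le_mul_of_nonneg_right (hbound' n) (hb0 n))

section Orbit

variable {f : ℍ → ℍ} {α β : ℝ} {μ : Measure ℝ}

lemma im_div_ofReal_pow (z : ℍ) (α : ℝ) (n : ℕ) :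
    ((z : ℂ) / (α : ℂ) ^ n).im = z.im / α ^ n := by
  rw [← Complex.ofReal_pow, Complex.div_ofReal_im, UpperHalfPlane.coe_im]

lemma IsRepresentedBy.orbitLimitInH_of_log (h : IsRepresentedBy f α β μ) (hα : 1 < α)
    (hlog : ∫⁻ t : ℝ, ENNReal.ofReal (Real.log (1 + |t|)) ∂μ < ⊤) (z : ℍ) :
    OrbitLimitInH f α z := by
  have := h.finite
  have hα0 : 0 < α := by linarith
  have hy0 := z.im_pos
  obtain ⟨A, hA, hsec⟩ := h.exists_norm_iterate_le hα z
  have hgrow := h.pow_mul_im_le_iterate z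
  have hnorm : ∀ n : ℕ, α ^ n * z.im ≤ ‖(f^[n] z : ℂ)‖ := fun n =>
    (hgrow n).trans ((le_abs_self _).trans (Complex.abs_im_le_norm (f^[n] z : ℂ)))
  set a : ℕ → ℝ := fun n => ∫ t : ℝ, min (|t| / α ^ n) 1 ∂μ with ha
  have ha0 : ∀ n, 0 ≤ a n := fun n => integral_nonneg fun t => by positivity
  have hasum : Summable a := summable_integral_min_of_log hα hlog
  have hgeo : Summable fun n : ℕ => (α⁻¹) ^ n :=
    summable_geometric_of_lt_one (by positivity) (inv_lt_one_of_one_lt₀ hα)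
  set C := |β| + 1 / z.im * μ.real Set.univ with hC
  have hC0 : 0 ≤ C := by positivity
  set B := (1 + A) * (1 + 1 / z.im) with hB
  have hB0 : 0 ≤ B := by positivity
  have hker : ∀ (n : ℕ) (t : ℝ), ‖herglotzKernel t (f^[n] z)‖ ≤
      1 / z.im + ‖(f^[n] z : ℂ)‖ * (B * min (|t| / α ^ n) 1) := by
    intro n t
    have hpow : 1 ≤ α ^ n := one_le_pow₀ hα.le
    have hpow0 : 0 < α ^ n := by positivity
    have hN := norm_nonneg (f^[n] z : ℂ)
    refine (norm_herglotzKernel_le t _ (hsec n)).trans (add_le_add ?_ ?_)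
    · refine one_div_le_one_div_of_le hy0 (le_trans ?_ (hgrow n))
      nlinarith
    · have hmin : min |t| ‖(f^[n] z : ℂ)‖ ≤
          ‖(f^[n] z : ℂ)‖ * ((1 + 1 / z.im) * min (|t| / α ^ n) 1) := by
        rcases min_choice (|t| / α ^ n) 1 with e | e <;> rw [e]
        · refine (min_le_left _ _).trans ?_
          have h1 : |t| ≤ ‖(f^[n] z : ℂ)‖ * (1 / z.im * (|t| / α ^ n)) := by
            have h2 := mul_le_mul_of_nonneg_left (hnorm n) (abs_nonneg t)
            have e2 : ‖(f^[n] z : ℂ)‖ * (1 / z.im * (|t| / α ^ n)) =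
                |t| * ‖(f^[n] z : ℂ)‖ / (α ^ n * z.im) := by
              field_simp
            rw [e2, le_div_iff₀ (by positivity)]
            exact h2
          refine h1.trans ?_
          gcongr
          linarith
        · refine (min_le_right _ _).trans (le_mul_of_one_le_right hN ?_)
          have : 0 ≤ 1 / z.im := by positivity
          linarith
      refine (mul_le_mul_of_nonneg_left hmin (by positivity : 0 ≤ 1 + A)).trans_eq ?_
      rw [hB]
      ring
  have hint : ∀ n : ℕ, ‖(β : ℂ) + ∫ t : ℝ, herglotzKernel t (f^[n] z) ∂μ‖ ≤
      ‖(f^[n] z : ℂ)‖ * (C / z.im * (α⁻¹) ^ n + B * a n) := by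
    intro n
    have hpow0 : 0 < α ^ n := by positivity
    have imin : Integrable (fun t : ℝ => min (|t| / α ^ n) 1) μ := by
      refine Integrable.of_bound (by fun_prop) 1 (ae_of_all _ fun t => ?_)
      rw [Real.norm_of_nonneg (by positivity)]
      exact min_le_right _ _
    have imin' := (imin.const_mul B).const_mul ‖(f^[n] z : ℂ)‖
    have b := norm_integral_le_of_norm_le ((integrable_const (1 / z.im)).add imin')
      (ae_of_all μ (hker n))
    simp only [Pi.add_apply] at b
    rw [integral_add (integrable_const _) imin', integral_const_mul, integral_const_mul,
      integral_const, smul_eq_mul] at b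
    have h1 : C ≤ ‖(f^[n] z : ℂ)‖ * (C / z.im * (α⁻¹) ^ n) := by
      have e : ‖(f^[n] z : ℂ)‖ * (C / z.im * (α⁻¹) ^ n) =
          C * ‖(f^[n] z : ℂ)‖ / (α ^ n * z.im) := by
        rw [inv_pow]
        field_simp
      rw [e, le_div_iff₀ (by positivity)]
      exact mul_le_mul_of_nonneg_left (hnorm n) hC0
    refine (norm_add_le _ _).trans ?_
    rw [Complex.norm_real, Real.norm_eq_abs, mul_add]
    linarith
  obtain ⟨L, hL⟩ := exists_tendsto_of_norm_sub_le_mul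
    (w := fun n : ℕ => (f^[n] z : ℂ) / (α : ℂ) ^ n)
    (b := fun n => C / z.im * (α⁻¹) ^ n + B * a n)
    (fun n => add_nonneg (by positivity) (mul_nonneg hB0 (ha0 n)))
    ((hgeo.mul_left _).add (hasum.mul_left _)) fun n => by
      have hαc : (α : ℂ) ≠ 0 := by exact_mod_cast hα0.ne'
      have e : (f^[n + 1] z : ℂ) / (α : ℂ) ^ (n + 1) - (f^[n] z : ℂ) / (α : ℂ) ^ n =
          ((β : ℂ) + ∫ t : ℝ, herglotzKernel t (f^[n] z) ∂μ) / (α : ℂ) ^ (n + 1) := by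
        rw [Function.iterate_succ_apply', h.eq_kernel]
        field_simp
        ring
      rw [e, norm_div, norm_div, norm_pow, norm_pow, Complex.norm_real,
        Real.norm_of_nonneg hα0.le, div_mul_eq_mul_div]
      refine div_le_div₀ ((norm_nonneg _).trans (hint n)) (hint n) (by positivity) ?_
      exact pow_le_pow_right₀ hα.le n.le_succ
  have him : z.im ≤ L.im := by
    refine ge_of_tendsto' ((Complex.continuous_im.tendsto L).comp hL) fun n => ?_
    rw [Function.comp_apply, im_div_ofReal_pow, le_div_iff₀ (by positivity), mul_comm]
    exact hgrow n
  exact ⟨⟨L, hy0.trans_le him⟩, hL⟩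

/-- For `|t| ≥ R ≥ |z|` one has `|t - z| ≤ 2|t|`, so the Poisson kernel is at least `1/4` there. -/
lemma measureReal_tail_le_poissonIntegral (μ : Measure ℝ) [IsFiniteMeasure μ] (z : ℍ) {R : ℝ}
    (hR : ‖(z : ℂ)‖ ≤ R) : μ.real {t | R ≤ |t|} ≤ 4 * poissonIntegral μ z := by
  have hms : MeasurableSet {t : ℝ | R ≤ |t|} :=
    measurableSet_le measurable_const measurable_id.abs
  have key : ∫ t : ℝ, {t : ℝ | R ≤ |t|}.indicator (fun _ => (1 / 4 : ℝ)) t ∂μ ≤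
      poissonIntegral μ z := by
    refine integral_mono ((integrable_const _).indicator hms) (integrable_poissonKernel μ z)
      fun t => Set.indicator_apply_le' (fun ht => ?_) fun _ => by positivity
    have hd : 0 < ‖(t : ℂ) - z‖ := norm_pos_iff.2 (ofReal_sub_ne_zero t z)
    have h1 : ‖(t : ℂ) - z‖ ≤ 2 * |t| := by
      refine (norm_sub_le _ _).trans ?_
      rw [Complex.norm_real, Real.norm_eq_abs]
      have ht' : R ≤ |t| := ht
      linarith
    rw [div_le_div_iff₀ (by norm_num) (by positivity)]
    have := pow_le_pow_left₀ hd.le h1 2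
    rw [mul_pow, sq_abs] at this
    linarith
  rw [integral_indicator_const _ hms, smul_eq_mul] at key
  linarith

lemma IsRepresentedBy.log_of_orbitLimitInH (h : IsRepresentedBy f α β μ) (hα : 1 < α) {z : ℍ}
    (hz : OrbitLimitInH f α z) :
    ∫⁻ t : ℝ, ENNReal.ofReal (Real.log (1 + |t|)) ∂μ < ⊤ := by
  have := h.finite
  have hα0 : 0 < α := by linarith
  have hy0 := z.im_pos
  obtain ⟨L, hL⟩ := hz
  obtain ⟨M, hM⟩ := hL.norm.bddAbove_range
  have hM' : ∀ n : ℕ, ‖(f^[n] z : ℂ) / (α : ℂ) ^ n‖ ≤ M := fun n => hM ⟨n, rfl⟩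
  have hM0 : 0 < M := by
    refine lt_of_lt_of_le (norm_pos_iff.2 ?_) (hM' 0)
    simpa using z.ne_zero
  have hnorm : ∀ n : ℕ, ‖(f^[n] z : ℂ)‖ ≤ M * α ^ n := fun n => by
    have := hM' n
    rwa [norm_div, norm_pow, Complex.norm_real, Real.norm_of_nonneg hα0.le,
      div_le_iff₀ (by positivity)] at this
  have hY : ∀ n : ℕ, (f^[n] z).im / α ^ n ≤ M := fun n => by
    rw [← im_div_ofReal_pow]
    exact (le_abs_self _).trans ((Complex.abs_im_le_norm _).trans (hM' n))
  -- The increment equals `(y_n / α^n) P(z_n) / α`, and `y_n / α^n ≥ Im z`.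
  have hstep : ∀ n : ℕ, μ.real {t | M * α ^ n ≤ |t|} ≤ 4 * α / z.im *
      ((f^[n + 1] z).im / α ^ (n + 1) - (f^[n] z).im / α ^ n) := by
    intro n
    have e : (f^[n + 1] z).im / α ^ (n + 1) - (f^[n] z).im / α ^ n =
        (f^[n] z).im / α ^ n * poissonIntegral μ (f^[n] z) / α := by
      rw [Function.iterate_succ_apply', h.im_eq]
      field_simp
      ring
    have h1 : z.im ≤ (f^[n] z).im / α ^ n := by
      rw [le_div_iff₀ (by positivity), mul_comm]
      exact h.pow_mul_im_le_iterate z n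
    have h2 := mul_le_mul_of_nonneg_right h1 (poissonIntegral_nonneg μ (f^[n] z))
    refine (measureReal_tail_le_poissonIntegral μ _ (hnorm n)).trans ?_
    have e2 : 4 * α / z.im * ((f^[n] z).im / α ^ n * poissonIntegral μ (f^[n] z) / α) =
        4 * ((f^[n] z).im / α ^ n * poissonIntegral μ (f^[n] z)) / z.im := by
      field_simp
    rw [e, e2, le_div_iff₀ hy0]
    linarith
  refine lintegral_log_lt_top_of_sum_tail_le hα hM0 (C := 4 * α / z.im * M) fun m => ?_
  refine (Finset.sum_le_sum fun n _ => hstep n).trans ?_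
  rw [← Finset.mul_sum, Finset.sum_range_sub fun n => (f^[n] z).im / α ^ n]
  have h0 : 0 ≤ (f^[0] z).im / α ^ 0 := by
    simpa using hy0.le
  refine mul_le_mul_of_nonneg_left ?_ (by positivity)
  linarith [hY m]

end Orbit

end HalfPlaneDynamics

theorem theorem4p3 (f : ℍ → ℍ) (hf : HalfPlaneDynamics.IsHyperbolic f)
    (α β : ℝ) (μ : Measure ℝ) (hrep : HalfPlaneDynamics.IsRepresentedBy f α β μ) :
    (HalfPlaneDynamics.IsOfExtremalRate f ↔
      ∫⁻ t : ℝ, ENNReal.ofReal (Real.log (1 + |t|)) ∂μ < ⊤) ∧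
    ((∀ z : ℍ, HalfPlaneDynamics.OrbitLimitInH f α z) ↔
      ∫⁻ t : ℝ, ENNReal.ofReal (Real.log (1 + |t|)) ∂μ < ⊤) := by
  obtain ⟨a, ha1, ha⟩ := hf.angularDeriv
  obtain rfl := hrep.angularDeriv_eq ha
  refine ⟨⟨?_, fun hlog => ⟨a, ha, UpperHalfPlane.I, hrep.orbitLimitInH_of_log ha1 hlog _⟩⟩,
    fun hz => hrep.log_of_orbitLimitInH ha1 (hz UpperHalfPlane.I),
    fun hlog z => hrep.orbitLimitInH_of_log ha1 hlog z⟩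
  rintro ⟨b, hb, z, hz⟩
  -- The rate `b` comes from the definition of extremal rate; it too must be the linear coefficient.
  obtain rfl := hrep.angularDeriv_eq hb
  exact hrep.log_of_orbitLimitInH ha1 hz
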